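/- Let $r\ge 0$, $B_r=\mathbb Z[e_1,\dots,e_r]$, $E_r(z)=1-e_1z+\cdots+(-1)^re_rz^r$, and $\sum_{i\ge0}h_iz^i=1/E_r(z)$, with $h_j=0$ for $j<0$. Let $M=\bigoplus_{i\ge0}\mathbb Z b_i$, and let $\phi_r:B_r\to\bigwedge^rM$ be the $\mathbb Z$-linear isomorphism that sends $\Delta_\lambda(H_r)=\det(h_{\lambda_j-j+i})_{1\le i,j\le r}$ to $[\mathbf b]^r_\lambda=b_{r-1+\lambda_1}\wedge b_{r-2+\lambda_2}\wedge\cdots\wedge b_{\lambda_r}$, for every partition $\lambda$ of length at most $r$. For $i,j\ge0$ let $\mathcal E_{ij}\in\mathrm{End}_{\mathbb Z}(M)$ be given by $\mathcal E_{ij}b_k=\delta_{jk}b_i$, and let $\delta(\mathcal E_{ij})$ be the derivation of $\bigwedge M$ that extends it. Define $\mathcal E(z,w)$ on $B_r$, with values in formal series in $z$ and $w^{-1}$ over $B_r$, by $$\phi_r\big(\mathcal E(z,w)P\big)=\sum_{i,j\ge 0}\delta(\mathcal E_{ij})\big(\phi_r(P)\big)\,z^iw^{-j}\qquad(P\in B_r).$$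 Let $\sigma_-(z):\bigwedge M\to(\bigwedge M)[z^{-1}]$ be the Hasse–Schmidt derivation (the additive map compatible with $\wedge$) with $\sigma_-(z)b_j=\sum_{i=0}^{j}b_{j-i}z^{-i}$, and let $\overline\sigma_-(z)$ be its inverse Hasse–Schmidt derivation, $\overline\sigma_-(z)b_j=b_j-b_{j-1}z^{-1}$ (with $b_{-1}=0$). Both are regarded, through $\phi_r$, as maps $B_r\to B_r[z^{-1}]$; in the composite $\sigma_-(w)\overline\sigma_-(z):B_r\to B_r[z^{-1},w^{-1}]$, the map $\sigma_-(w)$ acts on the coefficients of the powers of $z^{-1}$. Let $$\Gamma_r(z,w)=\frac{E_r(w)}{E_r(z)}\,\sigma_-(w)\,\overline\sigma_-(z),$$ where $1/E_r(z)$ is expanded in powers of $z$, and let $i_{w,z}\frac{w}{w-z}=\sum_{i\ge0}z^iw^{-i}$. Then for all $P\in B_r$, in $B_r[[z,w^{-1}]][z^{-1},w]$, $$\mathcal E(z,w)P=i_{w,z}\frac{w}{w-z}\left(P-\frac{z^r}{w^r}\,\Gamma_r(z,w)P\right).$$ -/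

import Mathlib

noncomputable section

namespace FiniteVertex

/-- The ring `B_r = ℤ[e_1, …, e_r]`; the variable with index `i : Fin r` is `e_{i+1}`. -/
abbrev B (r : ℕ) : Type := MvPolynomial (Fin r) ℤ

/-- The free abelian group `M` on `b_0, b_1, b_2, …`. -/
abbrev M : Type := ℕ →₀ ℤ

/-- The basis element `b_j` of `M`. -/
def b (j : ℕ) : M := Finsupp.single j 1

/-- The generic polynomial `E_r(z) = 1 - e_1 z + ⋯ + (-1)^r e_r z^r`. -/
def E (r : ℕ) : Polynomial (B r) :=
  1 + ∑ i : Fin r,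
    Polynomial.C ((-1) ^ ((i : ℕ) + 1) * MvPolynomial.X i) * Polynomial.X ^ ((i : ℕ) + 1)

/-- The power series `1 / E_r(z) = ∑ h_i z^i`. -/
def invE (r : ℕ) : PowerSeries (B r) := PowerSeries.invOfUnit (E r : PowerSeries (B r)) 1

/-- The sequence `H_r = (h_j)_{j ∈ ℤ}`, with `h_j = 0` for `j < 0`. -/
def h (r : ℕ) (j : ℤ) : B r := if 0 ≤ j then PowerSeries.coeff j.toNat (invE r) else 0

/-- The Schur determinant `Δ_λ(H_r) = det (h_{λ_j - j + i})_{1 ≤ i, j ≤ r}`. -/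
def schur {r : ℕ} (lam : Fin r → ℕ) : B r :=
  Matrix.det (Matrix.of fun i j : Fin r => h r ((lam j : ℤ) - (j : ℤ) + (i : ℤ)))

/-- `[b]^r_λ = b_{r-1+λ_1} ∧ b_{r-2+λ_2} ∧ ⋯ ∧ b_{λ_r}` in `⋀^r M`. -/
def bWedge {r : ℕ} (lam : Fin r → ℕ) : ⋀[ℤ]^r M :=
  exteriorPower.ιMulti ℤ r fun k : Fin r => b (r - 1 - (k : ℕ) + lam k)

/-- The determinant of the rows, as a `ℤ`-multilinear alternating map. -/
def detB (r : ℕ) : (Fin r → B r) [⋀^Fin r]→ₗ[ℤ] B r :=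
  { (Matrix.detRowAlternating (n := Fin r) (R := B r)).toMultilinearMap.restrictScalars ℤ with
    map_eq_zero_of_eq' := (Matrix.detRowAlternating (n := Fin r) (R := B r)).map_eq_zero_of_eq' }

/-- The map `b_{j_1} ∧ ⋯ ∧ b_{j_r} ↦ det (h_{j_k - r + i})_{1 ≤ i, k ≤ r}`. -/
def wedgeToB (r : ℕ) : ⋀[ℤ]^r M →ₗ[ℤ] B r :=
  exteriorPower.alternatingMapLinearEquiv
    ((detB r).compLinearMap
      (Finsupp.linearCombination ℤ fun (j : ℕ) (i : Fin r) =>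
        h r ((j : ℤ) - ((r : ℤ) - 1) + (i : ℤ))))

theorem wedgeToB_ιMulti (r : ℕ) (j : Fin r → ℕ) :
    wedgeToB r (exteriorPower.ιMulti ℤ r fun k => b (j k)) =
      Matrix.det (Matrix.of fun k i : Fin r => h r ((j k : ℤ) - ((r : ℤ) - 1) + (i : ℤ))) := by
  rw [wedgeToB, exteriorPower.alternatingMapLinearEquiv_apply_ιMulti]
  simp only [AlternatingMap.compLinearMap_apply, b, Finsupp.linearCombination_single, one_smul]
  rfl

theorem wedgeToB_bWedge {r : ℕ} (lam : Fin r → ℕ) : wedgeToB r (bWedge lam) = schur lam := by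
  rw [bWedge, wedgeToB_ιMulti, schur, ← Matrix.det_transpose]
  congr 1
  ext1 i k
  simp only [Matrix.transpose_apply, Matrix.of_apply]
  congr 1
  have := k.2
  omega


/-! ### Bijectivity of `wedgeToB`, through symmetric polynomials in `x_1, …, x_r` -/

/-- The polynomial ring `ℤ[x_1, …, x_r]`. -/
abbrev S (r : ℕ) : Type := MvPolynomial (Fin r) ℤ

/-- The embedding `B_r → ℤ[x_1, …, x_r]` that sends `e_i` to the elementary symmetric polynomial. -/
def toSym (r : ℕ) : B r →ₐ[ℤ] S r :=
  MvPolynomial.aeval fun i : Fin r => MvPolynomial.esymm (Fin r) ℤ ((i : ℕ) + 1)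

theorem toSym_injective (r : ℕ) : Function.Injective (toSym r) := by
  intro p q hpq
  apply MvPolynomial.esymmAlgHom_fin_injective ℤ (le_refl r)
  apply Subtype.ext
  rw [MvPolynomial.esymmAlgHom_apply, MvPolynomial.esymmAlgHom_apply]
  exact hpq

/-- `E_r(z)` factors as `∏ (1 - x_i z)`. -/
theorem map_E (r : ℕ) : (E r).map (toSym r).toRingHom =
    ∏ i : Fin r, (1 - Polynomial.C (MvPolynomial.X i : S r) * Polynomial.X) := by
  have h1 : ∀ i : Fin r, (1 - Polynomial.C (MvPolynomial.X i : S r) * Polynomial.X)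
    = 1 + Polynomial.C (-MvPolynomial.X i) * Polynomial.X := by
      intro i; rw [map_neg, sub_eq_add_neg]; congr 1; exact (neg_mul (Polynomial.C (MvPolynomial.X i : S r)) Polynomial.X).symm
  simp_rw [h1]
  rw [Finset.prod_one_add, Finset.sum_powerset, Finset.sum_range_succ']
  simp only [Finset.card_univ, Fintype.card_fin, Finset.powersetCard_zero, Finset.sum_singleton,
    Finset.prod_empty]
  rw [E, Polynomial.map_add, Polynomial.map_one, add_comm, Polynomial.map_sum,
    ← Fin.sum_univ_eq_sum_range (fun k => ∑ t ∈ Finset.powersetCard (k + 1) Finset.univ,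
      ∏ i ∈ t, (Polynomial.C (-MvPolynomial.X i : S r) * Polynomial.X)) r]
  congr 1
  refine Finset.sum_congr rfl fun i _ => ?_
  rw [Polynomial.map_mul, Polynomial.map_C, Polynomial.map_pow, Polynomial.map_X]
  have h2 : (toSym r).toRingHom ((-1) ^ ((i : ℕ) + 1) * MvPolynomial.X i) =
      (-1) ^ ((i : ℕ) + 1) * MvPolynomial.esymm (Fin r) ℤ ((i : ℕ) + 1) := by
    simp [toSym]
  rw [h2, MvPolynomial.esymm, Finset.mul_sum, map_sum, Finset.sum_mul]
  refine Finset.sum_congr rfl fun t ht => ?_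
  rw [Finset.mem_powersetCard] at ht
  rw [Finset.prod_mul_distrib, Finset.prod_const, ht.2, ← map_prod, Finset.prod_neg, ht.2]

/-- The alternant `det (x_i^{j_k})`. -/
def alternant (r : ℕ) (j : Fin r → ℕ) : S r :=
  Matrix.det (Matrix.of fun k i : Fin r => (MvPolynomial.X i : S r) ^ j k)

/-- `∏_{l ≠ i} (1 - x_l z)` -/
def cpol (r : ℕ) (i : Fin r) : Polynomial (S r) :=
  ∏ l ∈ Finset.univ.erase i, (1 - Polynomial.C (MvPolynomial.X l) * Polynomial.X)

theorem E_mul_invE (r : ℕ) : (E r : PowerSeries (B r)) * invE r = 1 := by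
  apply PowerSeries.mul_invOfUnit
  rw [← PowerSeries.coeff_zero_eq_constantCoeff_apply, Polynomial.coeff_coe]
  simp [E, Polynomial.coeff_zero_eq_eval_zero, Polynomial.eval_finsetSum]

theorem cpol_natDegree (r : ℕ) (i : Fin r) : (cpol r i).natDegree ≤ r - 1 := by
  refine (Polynomial.natDegree_prod_le _ _).trans ?_
  refine (Finset.sum_le_card_nsmul _ _ 1 fun l _ => ?_).trans ?_
  · compute_degree
  · simp

theorem cpol_mul (r : ℕ) (i : Fin r) :
    (cpol r i : PowerSeries (S r)) * (invE r).map (toSym r).toRingHom =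
      PowerSeries.mk fun n => (MvPolynomial.X i : S r) ^ n := by
  have h1 : ((1 - Polynomial.C (MvPolynomial.X i : S r) * Polynomial.X : Polynomial (S r)) :
      PowerSeries (S r)) * (PowerSeries.mk fun n => (MvPolynomial.X i : S r) ^ n) = 1 := by
    ext n
    cases n with
    | zero => simp
    | succ n => 
      simp [sub_mul, PowerSeries.coeff_succ_X_mul, mul_assoc, pow_succ', PowerSeries.coeff_one]
  have h2 : (1 - Polynomial.C (MvPolynomial.X i : S r) * Polynomial.X) * cpol r i =
      (E r).map (toSym r).toRingHom := by
    rw [map_E, cpol]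
    exact Finset.mul_prod_erase _ (fun l : Fin r =>
      (1 - Polynomial.C (MvPolynomial.X l : S r) * Polynomial.X)) (Finset.mem_univ i)
  have h3 := congrArg (PowerSeries.map (toSym r).toRingHom) (E_mul_invE r)
  rw [map_mul, map_one, ← Polynomial.polynomial_map_coe, ← h2, Polynomial.coe_mul] at h3
  calc _ = (cpol r i : PowerSeries (S r)) * (invE r).map (toSym r).toRingHom * 1 := by rw [mul_one]
    _ = _ := by
      rw [← h1]
      linear_combination h3 * (PowerSeries.mk fun n => (MvPolynomial.X i : S r) ^ n)

theorem pow_eq (r : ℕ) (i : Fin r) (n : ℕ) :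
    (MvPolynomial.X i : S r) ^ n =
      ∑ m : Fin r, toSym r (h r ((n : ℤ) - ((r : ℤ) - 1) + (m : ℤ))) *
        (cpol r i).coeff (r - 1 - (m : ℕ)) := by
  have h1 := congrArg (PowerSeries.coeff n) (cpol_mul r i)
  rw [PowerSeries.coeff_mk, PowerSeries.coeff_mul] at h1
  rw [← h1]
  symm
  rw [Finset.Nat.sum_antidiagonal_eq_sum_range_succ_mk]
  rw [← Finset.sum_filter_of_ne (p := fun k => k < r)]
  swap
  · intro k hk hne
    by_contra hc
    apply hne
    have : r ≠ 0 := fun h0 => by subst h0; exact i.elim0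
    rw [Polynomial.coeff_coe, Polynomial.coeff_eq_zero_of_natDegree_lt, zero_mul]
    exact (cpol_natDegree r i).trans_lt (by omega)
  rw [← Finset.sum_filter_of_ne (s := Finset.univ) (p := fun m : Fin r => r - 1 - (m : ℕ) ≤ n)]
  swap
  · intro m _ hne
    by_contra hc
    apply hne
    rw [h, if_neg (by omega), map_zero, zero_mul]
  refine Finset.sum_bij (fun m _ => r - 1 - (m : ℕ)) ?_ ?_ ?_ ?_
  · intro m hm
    have := m.2
    simp at hm ⊢
    omega
  · intro m _ m' _ hmm
    have := m.2
    have := m'.2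
    ext
    omega
  · intro k hk
    simp at hk
    refine ⟨⟨r - 1 - k, by omega⟩, ?_, ?_⟩
    · simp; omega
    · simp; omega
  · intro m hm
    have := m.2
    simp at hm
    rw [h, if_pos (by omega), Polynomial.coeff_coe, PowerSeries.coeff_map, mul_comm]
    have h0 : ((n : ℤ) - ((r : ℤ) - 1) + (m : ℤ)).toNat = n - (r - 1 - (m : ℕ)) := by omega
    rw [h0]
    rfl

/-- The matrix of coefficients of the polynomials `cpol`. -/
def cmat (r : ℕ) : Matrix (Fin r) (Fin r) (S r) :=
  Matrix.of fun m i => (cpol r i).coeff (r - 1 - (m : ℕ))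

theorem alternant_eq (r : ℕ) (j : Fin r → ℕ) :
    alternant r j =
      toSym r (wedgeToB r (exteriorPower.ιMulti ℤ r fun k => b (j k))) * (cmat r).det := by
  rw [wedgeToB_ιMulti, AlgHom.map_det, ← Matrix.det_mul, alternant]
  congr 1
  ext1 k i
  rw [Matrix.of_apply, pow_eq, Matrix.mul_apply]
  rfl

theorem cmat_det_ne_zero (r : ℕ) : (cmat r).det ≠ 0 := by
  intro h0
  have h1 := alternant_eq r fun k => k
  rw [h0, mul_zero, alternant, ← Matrix.det_transpose] at h1
  have h2 : (Matrix.vandermonde fun i : Fin r => (MvPolynomial.X i : S r)).det ≠ 0 := by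
    rw [Matrix.det_vandermonde_ne_zero_iff]
    exact MvPolynomial.X_injective
  exact h2 h1

theorem alternant_expand (r : ℕ) (s : Fin r → ℕ) :
    alternant r s = ∑ σ : Equiv.Perm (Fin r), Equiv.Perm.sign σ •
      ∏ i : Fin r, (MvPolynomial.X i : S r) ^ s (σ i) := by
  rw [alternant, Matrix.det_apply]
  rfl

theorem coeff_alternant (r : ℕ) (s t : Fin r → ℕ) (hs : StrictMono s) (ht : StrictMono t) :
    MvPolynomial.coeff (Finsupp.equivFunOnFinite.symm t) (alternant r s) =
      if s = t then 1 else 0 := by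
  have key : ∀ σ : Equiv.Perm (Fin r), (∏ i : Fin r, (MvPolynomial.X i : S r) ^ s (σ i)) =
      MvPolynomial.monomial (Finsupp.equivFunOnFinite.symm fun i => s (σ i)) 1 := by
    intro σ
    rw [MvPolynomial.monomial_eq, Finsupp.prod_fintype]
    · simp
    · simp
  have inj : ∀ σ : Equiv.Perm (Fin r), (fun i => s (σ i)) = t → s = t ∧ σ = 1 := by
    intro σ h
    have h1 : s = t := by
      apply (hs.range_inj ht).mp
      rw [← h]
      exact (σ.surjective.range_comp s).symm
    refine ⟨h1, Equiv.ext fun i => hs.injective ?_⟩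
    rw [← h1] at h
    exact congrFun h i
  rw [alternant_expand, MvPolynomial.coeff_sum]
  simp_rw [key, MvPolynomial.coeff_smul, MvPolynomial.coeff_monomial,
    Finsupp.equivFunOnFinite.symm.injective.eq_iff]
  split_ifs with hst
  · rw [Finset.sum_eq_single 1]
    · simp [hst]
    · intro σ _ hσ
      rw [if_neg fun h => hσ (inj σ h).2, smul_zero]
    · simp
  · refine Finset.sum_eq_zero fun σ _ => ?_
    rw [if_neg fun h => hst (inj σ h).1, smul_zero]

theorem esymm_mul_alternant (r m : ℕ) (j : Fin r → ℕ) :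
    MvPolynomial.esymm (Fin r) ℤ m * alternant r j =
      ∑ t ∈ Finset.powersetCard m Finset.univ,
        alternant r fun k => j k + if k ∈ t then 1 else 0 := by
  simp_rw [alternant_expand]
  rw [Finset.sum_comm, Finset.mul_sum]
  refine Finset.sum_congr rfl fun σ _ => ?_
  rw [mul_smul_comm, ← Finset.smul_sum, MvPolynomial.esymm, Finset.sum_mul]
  congr 1
  refine Finset.sum_bij (fun t _ => t.map σ.toEmbedding) ?_ ?_ ?_ ?_
  · intro t ht
    simpa using ht
  · intro t _ t' _ h
    exact Finset.map_injective _ h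
  · intro t ht
    refine ⟨t.map σ.symm.toEmbedding, by simpa using ht, ?_⟩
    ext k
    simp
  · intro t _
    simp only [pow_add, Finset.prod_mul_distrib]
    rw [mul_comm]
    congr 1
    rw [← Finset.prod_subset (Finset.subset_univ t)]
    · refine Finset.prod_congr rfl fun i hi => ?_
      simp [hi]
    · intro i _ hi
      simp [hi]

theorem X_mul_wedgeToB (r : ℕ) (i : Fin r) (j : Fin r → ℕ) :
    MvPolynomial.X i * wedgeToB r (exteriorPower.ιMulti ℤ r fun k => b (j k)) =
      ∑ t ∈ Finset.powersetCard ((i : ℕ) + 1) Finset.univ,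
        wedgeToB r (exteriorPower.ιMulti ℤ r fun k => b (j k + if k ∈ t then 1 else 0)) := by
  apply toSym_injective
  apply mul_right_cancel₀ (cmat_det_ne_zero r)
  rw [map_mul, mul_assoc, ← alternant_eq, map_sum, Finset.sum_mul]
  rw [toSym, MvPolynomial.aeval_X, esymm_mul_alternant]
  exact Finset.sum_congr rfl fun t _ => alternant_eq r _

theorem b_span : Submodule.span ℤ (Set.range b) = ⊤ := by
  have := (Finsupp.basisSingleOne (R := ℤ) (ι := ℕ)).span_eq
  rwa [Finsupp.coe_basisSingleOne] at this

theorem wedgeToB_surjective (r : ℕ) : Function.Surjective (wedgeToB r) := by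
  rw [← LinearMap.range_eq_top, eq_top_iff]
  rintro p -
  have hone : (1 : B r) ∈ LinearMap.range (wedgeToB r) := by
    refine ⟨exteriorPower.ιMulti ℤ r fun k => b (r - 1 - (k : ℕ)), ?_⟩
    rw [wedgeToB_ιMulti, Matrix.det_of_isUpperTriangular]
    · refine Finset.prod_eq_one fun k _ => ?_
      have := k.2
      rw [Matrix.of_apply, h, if_pos (by omega)]
      have h0 : (((r - 1 - (k : ℕ) : ℕ) : ℤ) - ((r : ℤ) - 1) + (k : ℤ)).toNat = 0 := by omega
      rw [h0, invE, PowerSeries.coeff_zero_eq_constantCoeff_apply,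
        PowerSeries.constantCoeff_invOfUnit]
      simp
    · intro k i hik
      have := k.2
      have : (i : ℕ) < k := hik
      rw [Matrix.of_apply, h, if_neg (by omega)]
  have hX : ∀ (i : Fin r) (x : B r), x ∈ LinearMap.range (wedgeToB r) →
      x * MvPolynomial.X i ∈ LinearMap.range (wedgeToB r) := by
    rintro i _ ⟨u, rfl⟩
    have hu : u ∈ Submodule.span ℤ (exteriorPower.ιMulti ℤ r '' {a | Set.range a ⊆ Set.range b}) := by
      rw [exteriorPower.ιMulti_span_of_span ℤ r M b_span]
      trivial
    induction hu using Submodule.span_induction with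
    | mem u hu =>
      obtain ⟨a, ha, rfl⟩ := hu
      choose j hj using fun k => ha (Set.mem_range_self k)
      obtain rfl : (fun k => b (j k)) = a := funext hj
      rw [mul_comm, X_mul_wedgeToB]
      exact Submodule.sum_mem _ fun t _ => LinearMap.mem_range_self _ _
    | zero => simp
    | add x y _ _ hx hy =>
      rw [map_add, add_mul]
      exact Submodule.add_mem _ hx hy
    | smul c x _ hx =>
      rw [map_smul, smul_mul_assoc]
      exact Submodule.smul_mem _ _ hx
  induction p using MvPolynomial.induction_on with
  | C a =>
    have := Submodule.smul_mem _ a hone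
    simpa [MvPolynomial.smul_eq_C_mul] using this
  | add p q hp hq => exact Submodule.add_mem _ hp hq
  | mul_X p i hp => exact hX i p hp

theorem wedgeToB_injective (r : ℕ) : Function.Injective (wedgeToB r) := by
  let bb := (Finsupp.basisSingleOne (R := ℤ) (ι := ℕ)).exteriorPower r
  let D : Set.powersetCard ℕ r → ⋀[ℤ]^r M →ₗ[ℤ] ℤ := fun t =>
    MvPolynomial.lcoeff ℤ (Finsupp.equivFunOnFinite.symm (Set.powersetCard.ofFinEmbEquiv.symm t)) ∘ₗ
      LinearMap.mulRight ℤ (cmat r).det ∘ₗ (toSym r).toLinearMap ∘ₗ wedgeToB r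
  have hD : ∀ t, D t = bb.coord t := by
    intro t
    refine bb.ext fun s => ?_
    have h1 : bb s = exteriorPower.ιMulti ℤ r fun k =>
        b ((Set.powersetCard.ofFinEmbEquiv.symm s) k) := by
      rw [exteriorPower.basis_apply, exteriorPower.ιMulti_family]
      rw [Finsupp.coe_basisSingleOne]
      rfl
    have h2 : D t (bb s) = MvPolynomial.coeff
        (Finsupp.equivFunOnFinite.symm (Set.powersetCard.ofFinEmbEquiv.symm t))
        (alternant r (Set.powersetCard.ofFinEmbEquiv.symm s)) := by
      rw [alternant_eq, ← h1]
      rfl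
    rw [h2, coeff_alternant _ _ _ (OrderEmbedding.strictMono _) (OrderEmbedding.strictMono _),
      Module.Basis.coord_apply, Module.Basis.repr_self, Finsupp.single_apply]
    congr 1
    rw [DFunLike.coe_fn_eq, EmbeddingLike.apply_eq_iff_eq]
  rw [injective_iff_map_eq_zero]
  intro u hu
  apply bb.forall_coord_eq_zero_iff.mp
  intro t
  rw [← hD t]
  simp [D, hu]


/-! ### The isomorphism between `B_r` and `⋀^r M` -/

theorem wedgeToB_bijective (r : ℕ) : Function.Bijective (wedgeToB r) :=
  ⟨wedgeToB_injective r, wedgeToB_surjective r⟩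

/-- The isomorphism `φ_r : B_r → ⋀^r M`, `Δ_λ(H_r) ↦ [b]^r_λ`. -/
def phi (r : ℕ) : B r ≃ₗ[ℤ] ⋀[ℤ]^r M :=
  (LinearEquiv.ofBijective (wedgeToB r) (wedgeToB_bijective r)).symm

theorem phi_schur {r : ℕ} (lam : Fin r → ℕ) : phi r (schur lam) = bWedge lam := by
  rw [phi, LinearEquiv.symm_apply_eq, LinearEquiv.ofBijective_apply, wedgeToB_bWedge]

/-! ### The representation of `gl_∞(ℤ)` on the exterior algebra -/

/-- The exterior algebra `⋀ M`. -/
abbrev Wedge : Type := ExteriorAlgebra ℤ M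

/-- The algebra map `⋀ M → (⋀ M)[ε]`, `ε² = 0`, with `u ↦ u + ε A u` for `u ∈ M`; the coefficient
of `ε` is the derivation extending `A`. -/
def dualLift (A : M →ₗ[ℤ] M) : Wedge →ₐ[ℤ] DualNumber Wedge :=
  ExteriorAlgebra.lift ℤ
    ⟨TrivSqZeroExt.inlAlgHom ℤ Wedge Wedge ∘ₗ ExteriorAlgebra.ι ℤ +
        (TrivSqZeroExt.inrHom Wedge Wedge).restrictScalars ℤ ∘ₗ ExteriorAlgebra.ι ℤ ∘ₗ A, by
      intro u
      ext
      · simp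
      · simp [ExteriorAlgebra.ι_add_mul_swap]⟩

/-- `δ(A)`, the derivation of `⋀ M` that extends `A`. -/
def delta (A : M →ₗ[ℤ] M) : Wedge →ₗ[ℤ] Wedge :=
  (TrivSqZeroExt.sndHom Wedge Wedge).restrictScalars ℤ ∘ₗ (dualLift A).toLinearMap

theorem dualLift_fst (A : M →ₗ[ℤ] M) (x : Wedge) : (dualLift A x).fst = x := by
  have : (TrivSqZeroExt.fstHom ℤ Wedge Wedge).comp (dualLift A) = AlgHom.id ℤ Wedge := by
    apply ExteriorAlgebra.hom_ext
    ext u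
    simp [dualLift]
  exact congrArg (fun f => f x) this

theorem delta_ι (A : M →ₗ[ℤ] M) (u : M) :
    delta A (ExteriorAlgebra.ι ℤ u) = ExteriorAlgebra.ι ℤ (A u) := by
  simp [delta, dualLift]

theorem delta_mul (A : M →ₗ[ℤ] M) (x y : Wedge) :
    delta A (x * y) = delta A x * y + x * delta A y := by
  simp [delta, dualLift_fst, add_comm]

theorem mul_mem_succ {r : ℕ} {x y : Wedge}
    (hx : x ∈ LinearMap.range (ExteriorAlgebra.ι ℤ (M := M))) (hy : y ∈ ⋀[ℤ]^r M) :
    x * y ∈ ⋀[ℤ]^(r + 1) M := by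
  have h1 := Submodule.mul_mem_mul hx hy
  rwa [ExteriorAlgebra.exteriorPower, ← pow_succ'] at h1

theorem delta_mem (A : M →ₗ[ℤ] M) (r : ℕ) (x : Wedge) (hx : x ∈ ⋀[ℤ]^r M) :
    delta A x ∈ ⋀[ℤ]^r M := by
  induction hx using Submodule.pow_induction_on_left' with
  | algebraMap c =>
    have h1 : delta A 1 = 0 := by simpa using delta_mul A 1 1
    rw [Algebra.algebraMap_eq_smul_one, map_smul, h1, smul_zero]
    exact Submodule.zero_mem _
  | add x y i _ _ hx hy =>
    rw [map_add]
    exact Submodule.add_mem _ hx hy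
  | mem_mul m hm i x hx ih =>
    obtain ⟨u, rfl⟩ := hm
    rw [delta_mul, delta_ι]
    refine Submodule.add_mem _ ?_ ?_
    · exact mul_mem_succ (LinearMap.mem_range_self _ _) hx
    · exact mul_mem_succ (LinearMap.mem_range_self _ _) ih

/-- The elementary endomorphism `b_i ⊗ β_j` of `M`, with `b_k ↦ δ_{jk} b_i`. -/
def elemEnd (i j : ℕ) : M →ₗ[ℤ] M := LinearMap.toSpanSingleton ℤ M (b i) ∘ₗ Finsupp.lapply j

/-- `δ(b_i ⊗ β_j)` on `⋀^r M`. -/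
def deltaElem (r i j : ℕ) : ⋀[ℤ]^r M →ₗ[ℤ] ⋀[ℤ]^r M :=
  (delta (elemEnd i j)).restrict (delta_mem (elemEnd i j) r)

/-! ### Schubert derivations -/

theorem hs_square (p : Polynomial Wedge)
    (hp : ∀ i, p.coeff i ∈ LinearMap.range (ExteriorAlgebra.ι ℤ (M := M))) : p * p = 0 := by
  have anti : ∀ i j, p.coeff i * p.coeff j = -(p.coeff j * p.coeff i) := by
    intro i j
    obtain ⟨u, hu⟩ := hp i
    obtain ⟨v, hv⟩ := hp j
    rw [← hu, ← hv, eq_neg_iff_add_eq_zero]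
    exact ExteriorAlgebra.ι_add_mul_swap u v
  have sq : ∀ i, p.coeff i * p.coeff i = 0 := by
    intro i
    obtain ⟨u, hu⟩ := hp i
    rw [← hu, ExteriorAlgebra.ι_sq_zero]
  ext n
  rw [Polynomial.coeff_mul, Polynomial.coeff_zero]
  refine Finset.sum_involution (fun a _ => a.swap) ?_ ?_ ?_ ?_
  · intro a _
    simp only [Prod.fst_swap, Prod.snd_swap]
    rw [anti a.1 a.2, neg_add_cancel]
  · rintro ⟨i, j⟩ _ hne heq
    apply hne
    have : j = i := congrArg Prod.fst heq
    subst this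
    exact sq _
  · intro a ha
    simpa [add_comm] using ha
  · intro a _
    exact Prod.swap_swap a

/-- The Hasse-Schmidt derivation `⋀ M → (⋀ M)[X]` (a map that is multiplicative for `∧`) with a
prescribed restriction `M → M[X]` to degree one. -/
def hs (f : M →ₗ[ℤ] Polynomial Wedge)
    (hf : ∀ u i, (f u).coeff i ∈ LinearMap.range (ExteriorAlgebra.ι ℤ (M := M))) :
    Wedge →ₐ[ℤ] Polynomial Wedge :=
  ExteriorAlgebra.lift ℤ ⟨f, fun u => hs_square (f u) (hf u)⟩

theorem hs_ι (f : M →ₗ[ℤ] Polynomial Wedge)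
    (hf : ∀ u i, (f u).coeff i ∈ LinearMap.range (ExteriorAlgebra.ι ℤ (M := M))) (u : M) :
    hs f hf (ExteriorAlgebra.ι ℤ u) = f u :=
  ExteriorAlgebra.lift_ι_apply ℤ f _ u

theorem hs_mem (f : M →ₗ[ℤ] Polynomial Wedge)
    (hf : ∀ u i, (f u).coeff i ∈ LinearMap.range (ExteriorAlgebra.ι ℤ (M := M)))
    (r : ℕ) (x : Wedge) (hx : x ∈ ⋀[ℤ]^r M) (n : ℕ) : (hs f hf x).coeff n ∈ ⋀[ℤ]^r M := by
  induction hx using Submodule.pow_induction_on_left' generalizing n with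
  | algebraMap c =>
    rw [AlgHom.commutes, Polynomial.algebraMap_apply, Polynomial.coeff_C]
    split_ifs
    · rw [ExteriorAlgebra.exteriorPower, pow_zero]
      exact Submodule.algebraMap_mem c
    · exact Submodule.zero_mem _
  | add x y i _ _ hx hy =>
    rw [map_add, Polynomial.coeff_add]
    exact Submodule.add_mem _ (hx n) (hy n)
  | mem_mul m hm i x hx ih =>
    obtain ⟨u, rfl⟩ := hm
    rw [map_mul, hs_ι, Polynomial.coeff_mul]
    refine Submodule.sum_mem _ fun a _ => ?_
    exact mul_mem_succ (hf u _) (ih _)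

/-- The restriction `M → M[X]` of `σ_-`: `b_j ↦ ∑_{0 ≤ i ≤ j} b_{j-i} X^i`. -/
def sigmaOne : M →ₗ[ℤ] Polynomial Wedge :=
  Finsupp.linearCombination ℤ fun j : ℕ =>
    ∑ i ∈ Finset.range (j + 1), Polynomial.monomial i (ExteriorAlgebra.ι ℤ (b (j - i)))

/-- The restriction `M → M[X]` of `σ̄_-`: `b_j ↦ b_j - b_{j-1} X`, with `b_{-1} = 0`. -/
def sigmaBarOne : M →ₗ[ℤ] Polynomial Wedge :=
  Finsupp.linearCombination ℤ fun j : ℕ =>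
    Polynomial.C (ExteriorAlgebra.ι ℤ (b j)) -
      if j = 0 then 0 else Polynomial.monomial 1 (ExteriorAlgebra.ι ℤ (b (j - 1)))

theorem linearCombination_coeff_mem (g : ℕ → Polynomial Wedge)
    (hg : ∀ j i, (g j).coeff i ∈ LinearMap.range (ExteriorAlgebra.ι ℤ (M := M))) (u : M) (i : ℕ) :
    (Finsupp.linearCombination ℤ g u).coeff i ∈
      LinearMap.range (ExteriorAlgebra.ι ℤ (M := M)) := by
  rw [Finsupp.linearCombination_apply, Finsupp.sum, Polynomial.finsetSum_coeff]
  refine Submodule.sum_mem _ fun j _ => ?_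
  rw [Polynomial.coeff_smul]
  exact Submodule.smul_mem _ _ (hg j i)

theorem sigmaOne_mem (u : M) (i : ℕ) :
    (sigmaOne u).coeff i ∈ LinearMap.range (ExteriorAlgebra.ι ℤ (M := M)) := by
  refine linearCombination_coeff_mem _ (fun j i => ?_) u i
  rw [Polynomial.finsetSum_coeff]
  refine Submodule.sum_mem _ fun k _ => ?_
  rw [Polynomial.coeff_monomial]
  split_ifs
  · exact LinearMap.mem_range_self _ _
  · exact Submodule.zero_mem _

theorem sigmaBarOne_mem (u : M) (i : ℕ) :
    (sigmaBarOne u).coeff i ∈ LinearMap.range (ExteriorAlgebra.ι ℤ (M := M)) := by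
  refine linearCombination_coeff_mem _ (fun j i => ?_) u i
  rw [Polynomial.coeff_sub]
  refine Submodule.sub_mem _ ?_ ?_
  · rw [Polynomial.coeff_C]
    split_ifs
    · exact LinearMap.mem_range_self _ _
    · exact Submodule.zero_mem _
  · split_ifs
    · exact Submodule.zero_mem _
    · rw [Polynomial.coeff_monomial]
      split_ifs
      · exact LinearMap.mem_range_self _ _
      · exact Submodule.zero_mem _

/-- The Schubert derivation `σ_-(z)` of `⋀ M`; the polynomial variable is `X = z⁻¹`. -/
def sigma : Wedge →ₐ[ℤ] Polynomial Wedge := hs sigmaOne sigmaOne_mem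

/-- The Schubert derivation `σ̄_-(z)` of `⋀ M`; the polynomial variable is `X = z⁻¹`. -/
def sigmaBar : Wedge →ₐ[ℤ] Polynomial Wedge := hs sigmaBarOne sigmaBarOne_mem

/-- The `X`-linear extension `(⋀ M)[X] → (⋀ M)[X]` of a Hasse-Schmidt derivation. -/
def extendX (D : Wedge →ₐ[ℤ] Polynomial Wedge) : Polynomial Wedge →+* Polynomial Wedge :=
  Polynomial.eval₂RingHom' D.toRingHom Polynomial.X fun a => (Polynomial.commute_X (D a)).symm

theorem sigmaOne_b (j : ℕ) : sigmaOne (b j) =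
    ∑ i ∈ Finset.range (j + 1), Polynomial.monomial i (ExteriorAlgebra.ι ℤ (b (j - i))) := by
  simp [sigmaOne, b]

theorem sigmaBarOne_b (j : ℕ) : sigmaBarOne (b j) = Polynomial.C (ExteriorAlgebra.ι ℤ (b j)) -
    if j = 0 then 0 else Polynomial.monomial 1 (ExteriorAlgebra.ι ℤ (b (j - 1))) := by
  simp [sigmaBarOne, b]

theorem sigmaOne_succ (j : ℕ) : sigmaOne (b (j + 1)) =
    Polynomial.C (ExteriorAlgebra.ι ℤ (b (j + 1))) + sigmaOne (b j) * Polynomial.X := by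
  rw [sigmaOne_b, sigmaOne_b, Finset.sum_range_succ', Finset.sum_mul, add_comm]
  congr 1
  refine Finset.sum_congr rfl fun i _ => ?_
  rw [Polynomial.monomial_mul_X, Nat.add_sub_add_right]

theorem extendX_C (D : Wedge →ₐ[ℤ] Polynomial Wedge) (x : Wedge) :
    extendX D (Polynomial.C x) = D x := by
  simp [extendX]

theorem extendX_X (D : Wedge →ₐ[ℤ] Polynomial Wedge) :
    extendX D Polynomial.X = Polynomial.X := by
  simp [extendX]

theorem extendX_eq (D D' : Wedge →ₐ[ℤ] Polynomial Wedge)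
    (hb : ∀ j, extendX D (D' (ExteriorAlgebra.ι ℤ (b j))) =
      Polynomial.C (ExteriorAlgebra.ι ℤ (b j))) (x : Wedge) :
    extendX D (D' x) = Polynomial.C x := by
  have : ((extendX D).toIntAlgHom.comp D') =
      (Polynomial.C : Wedge →+* Polynomial Wedge).toIntAlgHom := by
    apply ExteriorAlgebra.hom_ext
    apply Finsupp.lhom_ext'
    intro j
    ext1
    exact hb j
  exact congrArg (fun f => f x) this

/-- `σ̄_-` is the inverse of `σ_-`. -/
theorem sigmaBar_sigma (x : Wedge) : extendX sigmaBar (sigma x) = Polynomial.C x := by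
  refine extendX_eq _ _ (fun j => ?_) x
  rw [sigma, hs_ι]
  induction j with
  | zero => simp [sigmaOne_b, extendX_C, sigmaBar, hs_ι, sigmaBarOne_b]
  | succ j ih =>
    rw [sigmaOne_succ, map_add, map_mul, ih, extendX_C, extendX_X, sigmaBar, hs_ι, sigmaBarOne_b]
    simp [Polynomial.C_mul_X_eq_monomial]

theorem sigma_sigmaBar (x : Wedge) : extendX sigma (sigmaBar x) = Polynomial.C x := by
  refine extendX_eq _ _ (fun j => ?_) x
  rw [sigmaBar, hs_ι, sigmaBarOne_b]
  cases j with
  | zero => simp [sigmaOne_b, extendX_C, sigma, hs_ι]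
  | succ j =>
    rw [if_neg (Nat.succ_ne_zero j), ← Polynomial.C_mul_X_eq_monomial, map_sub, map_mul, extendX_C,
      extendX_C, extendX_X, sigma, hs_ι, hs_ι, sigmaOne_succ]
    simp

/-- A Hasse-Schmidt derivation, seen through `φ_r` as a map `B_r → B_r[X]`: the coefficient
of `X^i` in the image of `P` is `φ_r⁻¹ (D_i (φ_r P))`. -/
def onB (f : M →ₗ[ℤ] Polynomial Wedge)
    (hf : ∀ u i, (f u).coeff i ∈ LinearMap.range (ExteriorAlgebra.ι ℤ (M := M)))
    (r : ℕ) (P : B r) : Polynomial (B r) :=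
  ∑ i ∈ (hs f hf (phi r P : Wedge)).support,
    Polynomial.monomial i
      ((phi r).symm ⟨(hs f hf (phi r P : Wedge)).coeff i, hs_mem f hf r _ (phi r P).2 i⟩)

theorem onB_coeff (f : M →ₗ[ℤ] Polynomial Wedge)
    (hf : ∀ u i, (f u).coeff i ∈ LinearMap.range (ExteriorAlgebra.ι ℤ (M := M)))
    (r : ℕ) (P : B r) (i : ℕ) :
    (phi r ((onB f hf r P).coeff i) : Wedge) = (hs f hf (phi r P : Wedge)).coeff i := by
  rw [onB, Polynomial.finsetSum_coeff]
  simp_rw [Polynomial.coeff_monomial]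
  rw [Finset.sum_ite_eq' ]
  split_ifs with hi
  · rw [LinearEquiv.apply_symm_apply]
  · rw [map_zero, Submodule.coe_zero, Polynomial.notMem_support_iff.mp hi]

/-- `σ_-(z) : B_r → B_r[z⁻¹]`. -/
def sigmaB (r : ℕ) (P : B r) : Polynomial (B r) := onB sigmaOne sigmaOne_mem r P

/-- `σ̄_-(z) : B_r → B_r[z⁻¹]`. -/
def sigmaBarB (r : ℕ) (P : B r) : Polynomial (B r) := onB sigmaBarOne sigmaBarOne_mem r P

/-! ### Formal series in `z` and `w⁻¹` -/

/-- The ring `B_r[[z, w⁻¹]][z⁻¹, w]`; the coefficient at `(i, j) : ℤ × ℤ` is that of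
`z^i w^{-j}`. -/
abbrev Series (r : ℕ) : Type := HahnSeries (ℤ × ℤ) (B r)

/-- The series `∑_{i, j ≥ 0} f(i, j) z^i w^{-j}`. -/
def series {r : ℕ} (f : ℕ → ℕ → B r) : Series r where
  coeff p := if 0 ≤ p.1 ∧ 0 ≤ p.2 then f p.1.toNat p.2.toNat else 0
  isPWO_support' := by
    have h1 : ((fun q : ℕ × ℕ => ((q.1 : ℤ), (q.2 : ℤ))) '' Set.univ).IsPWO := by
      apply (Set.isPWO_of_wellQuasiOrderedLE Set.univ).image_of_monotone
      intro a c hac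
      exact ⟨Int.ofNat_le.mpr hac.1, Int.ofNat_le.mpr hac.2⟩
    refine h1.mono fun p hp => ?_
    have hp' : 0 ≤ p.1 ∧ 0 ≤ p.2 := by
      by_contra hc
      exact hp (if_neg hc)
    exact ⟨(p.1.toNat, p.2.toNat), Set.mem_univ _,
      Prod.ext (Int.toNat_of_nonneg hp'.1) (Int.toNat_of_nonneg hp'.2)⟩

/-- `z` -/
def z (r : ℕ) : Series r := HahnSeries.single (1, 0) 1

/-- `z⁻¹` -/
def zInv (r : ℕ) : Series r := HahnSeries.single (-1, 0) 1

/-- `w` -/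
def w (r : ℕ) : Series r := HahnSeries.single (0, -1) 1

/-- `w⁻¹` -/
def wInv (r : ℕ) : Series r := HahnSeries.single (0, 1) 1

theorem z_mul_zInv (r : ℕ) : z r * zInv r = 1 := by
  simp [z, zInv, HahnSeries.single_mul_single, Prod.mk_zero_zero]

theorem w_mul_wInv (r : ℕ) : w r * wInv r = 1 := by
  simp [w, wInv, HahnSeries.single_mul_single, Prod.mk_zero_zero]

/-- `i_{w,z} (w / (w - z)) = ∑_{i ≥ 0} z^i w^{-i}`. -/
def iwz (r : ℕ) : Series r := series fun i j => if i = j then 1 else 0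

/-- The generating operator `ℰ(z, w) : B_r → B_r[[z, w⁻¹]]`, defined by the equality
`φ_r (ℰ(z, w) P) = ∑_{i, j ≥ 0} δ(b_i ⊗ β_j) (φ_r P) z^i w^{-j}`. -/
def genE (r : ℕ) (P : B r) : Series r :=
  series fun i j => (phi r).symm (deltaElem r i j (phi r P))

/-- `E_r(w)` -/
def Ew (r : ℕ) : Series r := Polynomial.aeval (w r) (E r)

/-- `1 / E_r(z) = ∑_{i ≥ 0} h_i z^i` -/
def invEz (r : ℕ) : Series r := series fun i j => if j = 0 then h r i else 0

/-- `σ_-(w) σ̄_-(z) : B_r → B_r[z⁻¹, w⁻¹]`, where `σ_-(w)` acts on the coefficients of the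
polynomial `σ̄_-(z) P` in `z⁻¹`. -/
def sigmaSigmaBar (r : ℕ) (P : B r) : Series r :=
  (sigmaBarB r P).sum fun i Q => zInv r ^ i * Polynomial.aeval (wInv r) (sigmaB r Q)

/-- The vertex operator `Γ_r(z, w) = (E_r(w) / E_r(z)) σ_-(w) σ̄_-(z)`. -/
def Gamma (r : ℕ) (P : B r) : Series r := Ew r * invEz r * sigmaSigmaBar r P

end FiniteVertex

end

noncomputable section

namespace FiniteVertex

/-! ### Exterior algebras -/

/-! Embed `B r` in ℤ[x_1, …, x_r] and multiply by the nonzero factor `(cmat r).det`. Through `phi`,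
the wedge b_{J_1} ∧ ⋯ ∧ b_{J_r} becomes the alternant det(x_i^{J_k}), that is, the top form of the
vectors (x_1^j, …, x_r^j) with j = J_1, …, J_r. An identity in `B r` thus becomes one between
determinants (`alt_injective`, `topForm_wedgeMap`).

The Schubert derivations are multiplicative for ∧, so they act on each row separately: σ_-(w) turns
x^j into the divided difference (w^{-(j+1)} - x^{j+1})/(w^{-1} - x). The prefactor (z/w)^r
E_r(w)/E_r(z) splits into one factor z(w^{-1} - x_i)/(1 - x_i z) per column, which cancels the
denominators. By `factor_mul` the entry of row k, column i becomes x_i^{J_k} - (1 - z/w) w^{-J_k}/(1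
- x_i z).

This is a rank-one perturbation of (x_i^{J_k}), so its determinant is the alternant minus (1 - z/w)
∑_k w^{-J_k} D_k, where D_k has row k replaced by 1/(1 - x_i z) (`alt_Gamma_ιMulti`). Expanding 1/(1
- x_i z) = ∑ x_i^n z^n shows that ∑_k w^{-J_k} D_k is the generating series of the substitutions of
b_n for b_{J_k}, that is, the image of `genE` (`alt_genE_ιMulti`). -/

theorem alternating_sub_smul {K V N : Type*} [CommRing K] [AddCommGroup V] [Module K V]
    [AddCommGroup N] [Module K N] {ι : Type*} [Fintype ι] [DecidableEq ι]
    (f : V [⋀^ι]→ₗ[K] N) (m : ι → V) (a : ι → K) (c : V) :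
    f (fun k => m k - a k • c) = f m - ∑ k, a k • f (Function.update m k c) := by
  have h1 : (fun k => m k - a k • c) = (fun k => (-a k) • c) + m := by
    funext k
    simp [sub_eq_neg_add]
  rw [h1, f.map_add_univ]
  -- The expansion runs over the sets of slots that receive a multiple of `c`; only the empty set
  -- and the singletons contribute.
  rw [← Finset.sum_subset (s₁ := insert ∅ (Finset.univ.image fun k : ι => ({k} : Finset ι)))
    (Finset.subset_univ _)]
  · rw [Finset.sum_insert (by simp), Finset.sum_image (by intro i _ j _ hij; simpa using hij),
      Finset.piecewise_empty, sub_eq_add_neg, ← Finset.sum_neg_distrib]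
    congr 1
    refine Finset.sum_congr rfl fun k _ => ?_
    rw [Finset.piecewise_singleton, f.map_update_smul, neg_smul]
  · intro s _ hs
    have hs' : 1 < s.card := by
      by_contra hc
      apply hs
      rcases Nat.lt_or_eq_of_le (not_lt.mp hc) with h0 | h1
      · simp [Finset.card_eq_zero.mp (Nat.lt_one_iff.mp h0)]
      · obtain ⟨k, rfl⟩ := Finset.card_eq_one.mp h1
        simp
    obtain ⟨i, hi, j, hj, hij⟩ := Finset.one_lt_card.mp hs'
    -- Pulling the scalars out of the slots i ≠ j leaves `c` in both, and an alternating map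
    -- vanishes there.
    have h2 : s.piecewise (fun k => (-a k) • c) m = Function.update (Function.update
        (s.piecewise (fun k => (-a k) • c) m) i ((-a i) • c)) j ((-a j) • c) := by
      funext k
      by_cases hkj : k = j
      · subst hkj; simp [hj]
      · by_cases hki : k = i
        · subst hki; simp [hi, hkj]
        · simp [hki, hkj]
    rw [h2, f.map_update_smul, Function.update_comm hij, f.map_update_smul,
      f.map_eq_zero_of_eq _ _ hij, smul_zero, smul_zero]
    simp [hij.symm]

/-- A decomposable wedge is a product of degree-one elements, so any ring homomorphism acts on it
factor by factor, even across a change of base ring. -/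
theorem ringHom_ιMulti {R K U V : Type*} [CommRing R] [CommRing K] [AddCommGroup U] [Module R U]
    [AddCommGroup V] [Module K V] (F : ExteriorAlgebra R U →+* ExteriorAlgebra K V) {n : ℕ}
    (u : Fin n → U) (v : Fin n → V)
    (huv : ∀ k, F (ExteriorAlgebra.ι R (u k)) = ExteriorAlgebra.ι K (v k)) :
    F (ExteriorAlgebra.ιMulti R n u) = ExteriorAlgebra.ιMulti K n v := by
  rw [ExteriorAlgebra.ιMulti_apply, ExteriorAlgebra.ιMulti_apply, map_list_prod, List.map_ofFn]
  congr 2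
  funext k
  exact huv k

theorem delta_ιMulti (A : M →ₗ[ℤ] M) {n : ℕ} (u : Fin n → M) :
    delta A (ExteriorAlgebra.ιMulti ℤ n u) =
      ∑ k, ExteriorAlgebra.ιMulti ℤ n (Function.update u k (A (u k))) := by
  induction n with
  | zero =>
    have h1 : delta A 1 = 0 := by simpa using delta_mul A 1 1
    simp [h1]
  | succ n ih =>
    rw [ExteriorAlgebra.ιMulti_succ_apply, delta_mul, delta_ι, ih, Fin.sum_univ_succ,
      ExteriorAlgebra.ιMulti_succ_apply, Finset.mul_sum]
    congr 1
    refine Finset.sum_congr rfl fun k _ => ?_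
    rw [ExteriorAlgebra.ιMulti_succ_apply]
    congr 2
    funext l
    by_cases hl : l = k
    · subst hl; simp [Matrix.vecTail]
    · simp [Matrix.vecTail, hl]

theorem deltaElem_ιMulti (r i j : ℕ) (J : Fin r → ℕ) :
    deltaElem r i j (exteriorPower.ιMulti ℤ r fun k => b (J k)) =
      ∑ k, if J k = j then exteriorPower.ιMulti ℤ r (fun l => b (Function.update J k i l))
        else 0 := by
  apply Subtype.ext
  rw [deltaElem, LinearMap.coe_restrict_apply, exteriorPower.ιMulti_apply_coe, delta_ιMulti,
    AddSubmonoidClass.coe_finsetSum]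
  refine Finset.sum_congr rfl fun k _ => ?_
  by_cases hk : J k = j
  · rw [if_pos hk, exteriorPower.ιMulti_apply_coe]
    congr 1
    funext l
    by_cases hl : l = k
    · subst hl; simp [elemEnd, hk, b]
    · simp [hl]
  · rw [if_neg hk]
    have h0 : elemEnd i j (b (J k)) = 0 := by
      simp [elemEnd, b, hk]
    rw [h0]
    exact (ExteriorAlgebra.ιMulti ℤ r).map_coord_zero k (by simp)

/-- The index tuples need not be decreasing or injective. Spanning suffices to compare additive
maps, and no sorting or partitions are needed. -/
theorem exteriorPower_span_b (r : ℕ) :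
    Submodule.span ℤ (Set.range fun J : Fin r → ℕ => exteriorPower.ιMulti ℤ r fun k => b (J k)) =
      ⊤ := by
  rw [eq_top_iff, ← exteriorPower.ιMulti_span_of_span ℤ r M b_span]
  refine Submodule.span_mono ?_
  rintro _ ⟨a, ha, rfl⟩
  choose J hJ using fun k => ha (Set.mem_range_self k)
  exact ⟨J, congrArg _ (funext hJ)⟩

/-- The linear form on `⋀ K^r` that is the determinant in degree `r` and zero in the others. -/
def topForm (K : Type*) [CommRing K] (r : ℕ) : ExteriorAlgebra K (Fin r → K) →ₗ[K] K :=
  ExteriorAlgebra.liftAlternating (Pi.single r Matrix.detRowAlternating)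

theorem topForm_ιMulti (K : Type*) [CommRing K] (r : ℕ) (v : Fin r → Fin r → K) :
    topForm K r (ExteriorAlgebra.ιMulti K r v) = Matrix.det (Matrix.of v) := by
  rw [topForm, ExteriorAlgebra.liftAlternating_apply_ιMulti, Pi.single_eq_same]
  rfl

/-- The ring homomorphism of exterior algebras induced by an additive map `M → V`. -/
def wedgeMap {K V : Type*} [CommRing K] [AddCommGroup V] [Module K V] (f : M →+ V) :
    Wedge →+* ExteriorAlgebra K V :=
  (ExteriorAlgebra.lift ℤ
    ⟨((ExteriorAlgebra.ι K (M := V)).toAddMonoidHom.comp f).toIntLinearMap, fun u =>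
      ExteriorAlgebra.ι_sq_zero (f u)⟩).toRingHom

theorem wedgeMap_ι {K V : Type*} [CommRing K] [AddCommGroup V] [Module K V] (f : M →+ V) (u : M) :
    wedgeMap (K := K) f (ExteriorAlgebra.ι ℤ u) = ExteriorAlgebra.ι K (f u) :=
  ExteriorAlgebra.lift_ι_apply ℤ _ _ u

/-- The extension of a ring homomorphism from `⋀ M` to polynomials, sending the variable to the
scalar `t`. -/
def evalWedge {K V : Type*} [CommRing K] [AddCommGroup V] [Module K V]
    (F : Wedge →+* ExteriorAlgebra K V) (t : K) : Polynomial Wedge →+* ExteriorAlgebra K V :=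
  Polynomial.eval₂RingHom' F (algebraMap K _ t) fun a =>
    show Commute _ _ from (Algebra.commutes t (F a)).symm

theorem evalWedge_monomial {K V : Type*} [CommRing K] [AddCommGroup V] [Module K V]
    (F : Wedge →+* ExteriorAlgebra K V) (t : K) (n : ℕ) (x : Wedge) :
    evalWedge F t (Polynomial.monomial n x) = t ^ n • F x := by
  refine (Polynomial.eval₂_monomial F _).trans ?_
  rw [← map_pow, ← Algebra.commutes, ← Algebra.smul_def]

theorem evalWedge_C {K V : Type*} [CommRing K] [AddCommGroup V] [Module K V]
    (F : Wedge →+* ExteriorAlgebra K V) (t : K) (x : Wedge) :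
    evalWedge F t (Polynomial.C x) = F x := by
  rw [← Polynomial.monomial_zero_left, evalWedge_monomial, pow_zero, one_smul]

theorem evalWedge_eq_sum {K V : Type*} [CommRing K] [AddCommGroup V] [Module K V]
    (F : Wedge →+* ExteriorAlgebra K V) (t : K) (p : Polynomial Wedge) :
    evalWedge F t p = ∑ n ∈ p.support, t ^ n • F (p.coeff n) := by
  conv_lhs => rw [p.as_sum_support]
  rw [map_sum]
  exact Finset.sum_congr rfl fun n _ => evalWedge_monomial F t n _

theorem onB_support (f : M →ₗ[ℤ] Polynomial Wedge)
    (hf : ∀ u i, (f u).coeff i ∈ LinearMap.range (ExteriorAlgebra.ι ℤ (M := M)))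
    (r : ℕ) (P : B r) : (onB f hf r P).support = (hs f hf (phi r P : Wedge)).support := by
  ext i
  rw [Polynomial.mem_support_iff, Polynomial.mem_support_iff, ← onB_coeff, Ne, Ne,
    Submodule.coe_eq_zero, LinearEquiv.map_eq_zero_iff]

/-! ### Series over `ℤ[x_1, …, x_r]` -/

/-- The substitution of the monomial with exponent `v > 0` into a power series. -/
def subst {R : Type*} [CommRing R] (v : ℤ × ℤ) (hv : 0 < v) :
    PowerSeries R →+* HahnSeries (ℤ × ℤ) R :=
  (HahnSeries.embDomainRingHom (multiplesHom (ℤ × ℤ) v) (nsmul_left_strictMono hv).injective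
    fun _ _ => (nsmul_left_strictMono hv).le_iff_le).comp
      (HahnSeries.toPowerSeries (R := R)).symm.toRingHom

theorem subst_coeff_nsmul {R : Type*} [CommRing R] (v : ℤ × ℤ) (hv : 0 < v) (p : PowerSeries R)
    (n : ℕ) : (subst v hv p).coeff (n • v) = PowerSeries.coeff n p :=
  HahnSeries.embDomain_coeff

theorem subst_coeff_of_ne {R : Type*} [CommRing R] (v : ℤ × ℤ) (hv : 0 < v) (p : PowerSeries R)
    (q : ℤ × ℤ) (hq : ∀ n : ℕ, n • v ≠ q) : (subst v hv p).coeff q = 0 :=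
  HahnSeries.embDomain_of_notMem_range (by rintro ⟨n, hn⟩; exact hq n hn)

theorem subst_C {R : Type*} [CommRing R] (v : ℤ × ℤ) (hv : 0 < v) (a : R) :
    subst v hv (PowerSeries.C a) = HahnSeries.C a := by
  ext q
  by_cases hq : ∃ n : ℕ, n • v = q
  · obtain ⟨n, rfl⟩ := hq
    rw [subst_coeff_nsmul, PowerSeries.coeff_C, HahnSeries.C_apply, HahnSeries.coeff_single]
    rcases eq_or_ne n 0 with rfl | hn
    · simp
    · rw [if_neg hn, if_neg (smul_ne_zero hn hv.ne')]
  · push Not at hq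
    rw [subst_coeff_of_ne _ _ _ _ hq, HahnSeries.C_apply, HahnSeries.coeff_single, if_neg]
    rintro rfl
    exact hq 0 (zero_smul _ _)

theorem subst_X {R : Type*} [CommRing R] (v : ℤ × ℤ) (hv : 0 < v) :
    subst v hv (PowerSeries.X : PowerSeries R) = HahnSeries.single v 1 := by
  ext q
  by_cases hq : ∃ n : ℕ, n • v = q
  · obtain ⟨n, rfl⟩ := hq
    rw [subst_coeff_nsmul, PowerSeries.coeff_X, HahnSeries.coeff_single]
    have : n • v = v ↔ n = 1 := by
      conv_lhs => rhs; rw [← one_smul ℕ v]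
      exact (nsmul_left_strictMono hv).injective.eq_iff
    simp only [this]
  · push Not at hq
    rw [subst_coeff_of_ne _ _ _ _ hq, HahnSeries.coeff_single, if_neg]
    rintro rfl
    exact hq 1 (one_smul _ _)

theorem subst_polynomial {R : Type*} [CommRing R] (v : ℤ × ℤ) (hv : 0 < v) (p : Polynomial R) :
    subst v hv (p : PowerSeries R) = p.eval₂ HahnSeries.C (HahnSeries.single v 1) := by
  have h1 : (subst v hv).comp (Polynomial.coeToPowerSeries.ringHom (R := R)) =
      Polynomial.eval₂RingHom HahnSeries.C (HahnSeries.single v 1) := by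
    ext a : 2
    · simp [subst_C]
    · simp [subst_X]
  exact congrArg (fun f => f p) h1

theorem z_pos : (0 : ℤ × ℤ) < (1, 0) := Prod.mk_lt_mk.mpr (Or.inl (by simp))

theorem zw_pos : (0 : ℤ × ℤ) < (1, 1) := Prod.mk_lt_mk.mpr (Or.inl (by simp))

/-- `series` is defined by coefficients alone; written as the image of a ring homomorphism, it
inherits the identities of power series in one variable. -/
theorem invEz_eq_subst (r : ℕ) : invEz r = subst (1, 0) z_pos (invE r) := by
  ext ⟨i, j⟩ : 2
  by_cases hq : ∃ n : ℕ, n • ((1 : ℤ), (0 : ℤ)) = (i, j)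
  · obtain ⟨n, hn⟩ := hq
    rw [← hn, subst_coeff_nsmul]
    simp [invEz, series, h]
  · rw [subst_coeff_of_ne _ _ _ _ fun n hn => hq ⟨n, hn⟩]
    simp only [invEz, series]
    split_ifs with h1 h2
    · exact absurd ⟨i.toNat, by simp; omega⟩ hq
    · rfl
    · rfl

theorem iwz_eq_subst (r : ℕ) : iwz r = subst (1, 1) zw_pos (PowerSeries.mk fun _ => 1) := by
  ext ⟨i, j⟩ : 2
  by_cases hq : ∃ n : ℕ, n • ((1 : ℤ), (1 : ℤ)) = (i, j)
  · obtain ⟨n, hn⟩ := hq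
    rw [← hn, subst_coeff_nsmul]
    simp [iwz, series]
  · rw [subst_coeff_of_ne _ _ _ _ fun n hn => hq ⟨n, hn⟩]
    simp only [iwz, series]
    split_ifs with h1 h2
    · exact absurd ⟨i.toNat, by simp; omega⟩ hq
    · rfl
    · rfl

theorem z_mul_wInv (r : ℕ) : z r * wInv r = HahnSeries.single (1, 1) 1 := by
  simp [z, wInv, HahnSeries.single_mul_single]

/-- The geometric series in z/w; this lets w/(w - z) be cleared from the main formula. -/
theorem iwz_mul (r : ℕ) : iwz r * (1 - z r * wInv r) = 1 := by
  rw [z_mul_wInv, ← subst_X _ zw_pos, iwz_eq_subst, ← map_one (subst (1, 1) zw_pos), ← map_sub,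
    ← map_mul]
  exact congrArg _ (PowerSeries.mk_one_mul_one_sub_eq_one _)

/-- The coefficientwise extension of `toSym` to series. -/
def mapSym (r : ℕ) : Series r →+* HahnSeries (ℤ × ℤ) (S r) where
  toFun f := f.map (toSym r).toRingHom
  map_zero' := by ext; simp
  map_one' := by
    ext q : 2
    simp only [HahnSeries.map_coeff, HahnSeries.coeff_one]
    split_ifs <;> simp
  map_add' f g := by ext; simp
  map_mul' f g := HahnSeries.map_mul ((toSym r).toRingHom : B r →ₙ+* S r)

theorem mapSym_coeff (r : ℕ) (f : Series r) (q : ℤ × ℤ) :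
    (mapSym r f).coeff q = toSym r (f.coeff q) := rfl

theorem mapSym_single (r : ℕ) (q : ℤ × ℤ) (a : B r) :
    mapSym r (HahnSeries.single q a) = HahnSeries.single q (toSym r a) :=
  HahnSeries.map_single (toSym r).toRingHom.toMonoidWithZeroHom.toZeroHom

theorem mapSym_C (r : ℕ) (a : B r) : mapSym r (HahnSeries.C a) = HahnSeries.C (toSym r a) :=
  mapSym_single r 0 a

/-- The additive map `Series r → HahnSeries (ℤ × ℤ) (S r)` that multiplies by the Vandermonde
determinant. -/
def alt (r : ℕ) (f : Series r) : HahnSeries (ℤ × ℤ) (S r) :=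
  mapSym r f * HahnSeries.C (cmat r).det

/-- Coefficientwise, `toSym` is injective and a nonzero element of a domain can be cancelled. -/
theorem alt_injective (r : ℕ) : Function.Injective (alt r) := by
  intro f g hfg
  ext q : 2
  have h1 := congrArg (fun x => x.coeff q) hfg
  simp only [alt, HahnSeries.C_apply, HahnSeries.coeff_mul_single_zero, mapSym_coeff] at h1
  exact toSym_injective r (mul_right_cancel₀ (cmat_det_ne_zero r) h1)

/-- `alt` is not multiplicative: the determinant factor must be carried by exactly one of the two
series. -/
theorem alt_mul (r : ℕ) (f g : Series r) : alt r (f * g) = mapSym r f * alt r g := by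
  rw [alt, alt, map_mul, mul_assoc]

/-- The variable `x_i` as a constant series. -/
def xs {r : ℕ} (i : Fin r) : HahnSeries (ℤ × ℤ) (S r) := HahnSeries.C (MvPolynomial.X i)

/-- `1 / (1 - x_i z)` -/
def geom {r : ℕ} (i : Fin r) : HahnSeries (ℤ × ℤ) (S r) :=
  subst (1, 0) z_pos (PowerSeries.mk fun n => (MvPolynomial.X i : S r) ^ n)

theorem mapSym_z (r : ℕ) : mapSym r (z r) = HahnSeries.single (1, 0) 1 := by
  rw [z, mapSym_single, map_one]

theorem one_sub_mul_geom {r : ℕ} (i : Fin r) : (1 - xs i * mapSym r (z r)) * geom i = 1 := by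
  have h1 : (1 - PowerSeries.C (MvPolynomial.X i : S r) * PowerSeries.X) *
      (PowerSeries.mk fun n => (MvPolynomial.X i : S r) ^ n) = 1 := by
    ext n
    cases n with
    | zero => simp
    | succ n =>
      simp [sub_mul, PowerSeries.coeff_succ_X_mul, mul_assoc, pow_succ', PowerSeries.coeff_one]
  have h2 := congrArg (subst (1, 0) z_pos) h1
  rwa [map_mul, map_sub, map_mul, map_one, subst_C, subst_X, ← mapSym_z] at h2

/-- Stated for any `t` because `subst` covers only positive exponents, while w has exponent (0, -1).
-/
theorem mapSym_eval₂_E (r : ℕ) (t : Series r) :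
    mapSym r ((E r).eval₂ HahnSeries.C t) = ∏ i, (1 - xs i * mapSym r t) := by
  have h1 : ((mapSym r).comp HahnSeries.C) =
      (HahnSeries.C : S r →+* HahnSeries (ℤ × ℤ) (S r)).comp (toSym r).toRingHom := by
    apply RingHom.ext
    exact mapSym_C r
  rw [Polynomial.hom_eval₂, h1, ← Polynomial.eval₂_map, map_E, Polynomial.eval₂_finsetProd]
  refine Finset.prod_congr rfl fun i _ => ?_
  simp [xs]

theorem mapSym_Ew (r : ℕ) : mapSym r (Ew r) = ∏ i, (1 - xs i * mapSym r (w r)) := by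
  rw [← mapSym_eval₂_E, Ew, Polynomial.aeval_def]
  rfl

/-- Uniqueness of inverses: both sides invert ∏ (1 - x_i z). -/
theorem mapSym_invEz (r : ℕ) : mapSym r (invEz r) = ∏ i : Fin r, geom i := by
  have h1 := congrArg (fun p => mapSym r (subst (1, 0) z_pos p)) (E_mul_invE r)
  simp only [map_mul, map_one] at h1
  rw [subst_polynomial, ← invEz_eq_subst, mapSym_eval₂_E] at h1
  have h2 : (∏ i : Fin r, (1 - xs i * mapSym r (z r))) * ∏ i : Fin r, geom i = 1 := by
    rw [← Finset.prod_mul_distrib]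
    exact Finset.prod_eq_one fun i _ => one_sub_mul_geom i
  calc _ = mapSym r (invEz r) * ((∏ i : Fin r, (1 - xs i * mapSym r (z r))) *
        ∏ i : Fin r, geom i) := by rw [h2, mul_one]
    _ = _ := by
      change (∏ i : Fin r, (1 - xs i * mapSym r (z r))) * _ = 1 at h1
      linear_combination (∏ i : Fin r, geom i) * h1

/-! ### Wedges as determinants over series -/

/-- The evaluation `M → K^r`, `b_j ↦ (x_1^j, …, x_r^j)`, over series. -/
def evalX (r : ℕ) : M →+ (Fin r → HahnSeries (ℤ × ℤ) (S r)) :=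
  (Finsupp.linearCombination ℤ fun (j : ℕ) (i : Fin r) => xs i ^ j).toAddMonoidHom

theorem evalX_b (r j : ℕ) : evalX r (b j) = fun i => xs i ^ j := by
  simp [evalX, b]

theorem exteriorPower_addHom_ext {r : ℕ} {A : Type*} [AddCommGroup A] {f g : ⋀[ℤ]^r M →+ A}
    (hfg : ∀ J : Fin r → ℕ, f (exteriorPower.ιMulti ℤ r fun k => b (J k)) =
      g (exteriorPower.ιMulti ℤ r fun k => b (J k))) : f = g := by
  have h1 : f.toIntLinearMap = g.toIntLinearMap := by
    apply LinearMap.ext_on (exteriorPower_span_b r)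
    rintro _ ⟨J, rfl⟩
    exact hfg J
  exact congrArg LinearMap.toAddMonoidHom h1

theorem C_alternant (r : ℕ) (J : Fin r → ℕ) :
    HahnSeries.C (alternant r J) =
      Matrix.det (Matrix.of fun k i : Fin r => (xs i : HahnSeries (ℤ × ℤ) (S r)) ^ J k) := by
  rw [alternant, RingHom.map_det]
  congr 1
  ext k i : 2
  simp [xs]

/-- The bridge between the two pictures; on a wedge of basis vectors both sides are the alternant.
-/
theorem topForm_wedgeMap (r : ℕ) (y : ⋀[ℤ]^r M) :
    topForm (HahnSeries (ℤ × ℤ) (S r)) r (wedgeMap (evalX r) (y : Wedge)) =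
      HahnSeries.C (toSym r (wedgeToB r y) * (cmat r).det) := by
  have h1 : ((topForm (HahnSeries (ℤ × ℤ) (S r)) r).toAddMonoidHom.comp
      (wedgeMap (evalX r)).toAddMonoidHom).comp (⋀[ℤ]^r M).subtype.toAddMonoidHom =
      ((HahnSeries.C (Γ := ℤ × ℤ)).toAddMonoidHom.comp
        (AddMonoidHom.mulRight (cmat r).det)).comp
        ((toSym r).toRingHom.toAddMonoidHom.comp (wedgeToB r).toAddMonoidHom) := by
    apply exteriorPower_addHom_ext
    intro J
    change topForm (HahnSeries (ℤ × ℤ) (S r)) r (wedgeMap (evalX r)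
      (exteriorPower.ιMulti ℤ r fun k => b (J k) : ⋀[ℤ]^r M)) =
      HahnSeries.C (toSym r (wedgeToB r (exteriorPower.ιMulti ℤ r fun k => b (J k))) *
        (cmat r).det)
    rw [← alternant_eq, C_alternant, exteriorPower.ιMulti_apply_coe,
      ringHom_ιMulti _ _ (fun k i => xs i ^ J k), topForm_ιMulti]
    intro k
    rw [wedgeMap_ι, evalX_b]
  exact congrArg (fun f => f y) h1

theorem wedgeToB_phi (r : ℕ) (P : B r) : wedgeToB r (phi r P) = P :=
  (phi r).symm_apply_apply P

theorem alt_C (r : ℕ) (Q : B r) :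
    alt r (HahnSeries.C Q) = topForm _ r (wedgeMap (evalX r) (phi r Q : Wedge)) := by
  rw [topForm_wedgeMap, wedgeToB_phi, alt, mapSym_C, map_mul]

/-- Used twice: with constants as `F` and t = w^{-1} it gives σ_-(w); with that result as `F` and t
= z^{-1} it gives the composite σ_-(w) σ̄_-(z). -/
theorem alt_onB_sum (r : ℕ) (f : M →ₗ[ℤ] Polynomial Wedge)
    (hf : ∀ u i, (f u).coeff i ∈ LinearMap.range (ExteriorAlgebra.ι ℤ (M := M)))
    (F : B r → Series r)
    (H : Wedge →+* ExteriorAlgebra (HahnSeries (ℤ × ℤ) (S r))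
      (Fin r → HahnSeries (ℤ × ℤ) (S r)))
    (hFH : ∀ Q, alt r (F Q) = topForm _ r (H (phi r Q : Wedge))) (t : Series r) (P : B r) :
    alt r ((onB f hf r P).sum fun i Q => t ^ i * F Q) =
      topForm _ r (evalWedge H (mapSym r t) (hs f hf (phi r P : Wedge))) := by
  rw [evalWedge_eq_sum, Polynomial.sum_def, onB_support, alt, map_sum, Finset.sum_mul, map_sum]
  refine Finset.sum_congr rfl fun i _ => ?_
  rw [map_mul, mul_assoc, map_pow, map_smul, smul_eq_mul, ← onB_coeff, ← hFH]
  rfl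

theorem alt_aeval_sigmaB (r : ℕ) (Q : B r) :
    alt r (Polynomial.aeval (wInv r) (sigmaB r Q)) =
      topForm _ r (evalWedge (wedgeMap (evalX r)) (mapSym r (wInv r))
        (sigma (phi r Q : Wedge))) := by
  rw [sigma, ← alt_onB_sum r sigmaOne sigmaOne_mem HahnSeries.C _ (alt_C r),
    Polynomial.aeval_def, Polynomial.eval₂_eq_sum]
  congr 2
  funext i a
  exact mul_comm _ _

/-- `σ_-(w)` with values in the exterior algebra over series. -/
def sigmaEval (r : ℕ) : Wedge →+* ExteriorAlgebra (HahnSeries (ℤ × ℤ) (S r))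
    (Fin r → HahnSeries (ℤ × ℤ) (S r)) :=
  (evalWedge (wedgeMap (evalX r)) (mapSym r (wInv r))).comp sigma.toRingHom

/-- `σ_-(w) σ̄_-(z)` with values in the exterior algebra over series. -/
def sigmaSigmaBarEval (r : ℕ) : Wedge →+* ExteriorAlgebra (HahnSeries (ℤ × ℤ) (S r))
    (Fin r → HahnSeries (ℤ × ℤ) (S r)) :=
  (evalWedge (sigmaEval r) (mapSym r (zInv r))).comp sigmaBar.toRingHom

theorem alt_sigmaSigmaBar (r : ℕ) (P : B r) :
    alt r (sigmaSigmaBar r P) = topForm _ r (sigmaSigmaBarEval r (phi r P : Wedge)) :=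
  alt_onB_sum r sigmaBarOne sigmaBarOne_mem _ (sigmaEval r) (alt_aeval_sigmaB r) (zInv r) P

/-! ### The vertex operator on rows and columns -/

/-- `∑_{l < n} x_i^{n-1-l} w^{-l}`, so that `σ_-(w) b_j` evaluates to `divDiff r (j + 1)`. -/
def divDiff (r n : ℕ) (i : Fin r) : HahnSeries (ℤ × ℤ) (S r) :=
  ∑ l ∈ Finset.range n, mapSym r (wInv r) ^ l * xs i ^ (n - 1 - l)

theorem mapSym_w_mul_wInv (r : ℕ) : mapSym r (w r) * mapSym r (wInv r) = 1 := by
  rw [← map_mul, w_mul_wInv, map_one]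

theorem mapSym_z_mul_zInv (r : ℕ) : mapSym r (z r) * mapSym r (zInv r) = 1 := by
  rw [← map_mul, z_mul_zInv, map_one]

/-- Since w^{-1}(1 - xw) = w^{-1} - x, the sum telescopes. -/
theorem wInv_mul_divDiff (r n : ℕ) (i : Fin r) :
    mapSym r (wInv r) * (1 - xs i * mapSym r (w r)) * divDiff r n i =
      mapSym r (wInv r) ^ n - xs i ^ n := by
  have h1 := (Commute.all (mapSym r (wInv r)) (xs i)).geom_sum₂_mul n
  rw [← h1, divDiff]
  linear_combination (-xs i *
    ∑ l ∈ Finset.range n, mapSym r (wInv r) ^ l * xs i ^ (n - 1 - l)) * mapSym_w_mul_wInv r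

theorem sigmaEval_b (r j : ℕ) :
    sigmaEval r (ExteriorAlgebra.ι ℤ (b j)) = ExteriorAlgebra.ι _ (divDiff r (j + 1)) := by
  change evalWedge _ _ (sigma _) = _
  rw [sigma, hs_ι, sigmaOne_b, map_sum]
  simp_rw [evalWedge_monomial, wedgeMap_ι, evalX_b, ← map_smul]
  rw [← map_sum]
  congr 1
  funext i
  simp [divDiff]

theorem sigmaSigmaBarEval_b (r j : ℕ) :
    sigmaSigmaBarEval r (ExteriorAlgebra.ι ℤ (b j)) =
      ExteriorAlgebra.ι _ (divDiff r (j + 1) - mapSym r (zInv r) • divDiff r j) := by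
  change evalWedge _ _ (sigmaBar _) = _
  rw [sigmaBar, hs_ι, sigmaBarOne_b, map_sub, evalWedge_C, sigmaEval_b, map_sub]
  congr 1
  cases j with
  -- The convention b_{-1} = 0 agrees with the empty sum `divDiff r 0`.
  | zero =>
    have h0 : divDiff r 0 = 0 := by
      funext i
      simp [divDiff]
    simp [h0]
  | succ j =>
    rw [if_neg (Nat.succ_ne_zero j), evalWedge_monomial, Nat.add_sub_cancel, sigmaEval_b, pow_one,
      map_smul]

/-- The factor of `(z/w)^r E_r(w) / E_r(z)` that belongs to `x_i`. -/
def factor {r : ℕ} (i : Fin r) : HahnSeries (ℤ × ℤ) (S r) :=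
  mapSym r (z r * wInv r) * (1 - xs i * mapSym r (w r)) * geom i

theorem mapSym_prefactor (r : ℕ) :
    mapSym r ((z r * wInv r) ^ r * (Ew r * invEz r)) = ∏ i : Fin r, factor i := by
  simp only [factor]
  rw [map_mul, map_mul, mapSym_Ew, mapSym_invEz, Finset.prod_mul_distrib, Finset.prod_mul_distrib,
    Finset.prod_const, Finset.card_univ, Fintype.card_fin, map_pow, mul_assoc]

/-- The central computation. Both divided differences have denominator w^{-1} - x, which the column
factor cancels; what is left is (x^j - z x^{j+1} - w^{-j} + z w^{-j-1})/(1 - xz), and x^j - z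
x^{j+1} = x^j (1 - xz). -/
theorem factor_mul (r j : ℕ) (i : Fin r) :
    factor i * (divDiff r (j + 1) - mapSym r (zInv r) • divDiff r j) i =
      xs i ^ j - (1 - mapSym r (z r * wInv r)) * mapSym r (wInv r) ^ j * geom i := by
  have h1 := wInv_mul_divDiff r (j + 1) i
  have h2 := wInv_mul_divDiff r j i
  have h3 := mapSym_z_mul_zInv r
  have h4 := one_sub_mul_geom i
  rw [factor, map_mul, Pi.sub_apply, Pi.smul_apply, smul_eq_mul]
  -- Only the four relations `h1`–`h4` matter, so the series are treated as commuting
  -- indeterminates.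
  generalize mapSym r (wInv r) = wi at *
  generalize mapSym r (zInv r) = zi at *
  generalize mapSym r (z r) = zz at *
  generalize mapSym r (w r) = ww at *
  generalize geom i = g at *
  generalize xs i = x at *
  linear_combination zz * g * h1 - zz * zi * g * h2 - (wi ^ j - x ^ j) * g * h3 + x ^ j * h4

theorem det_sub_mul_row {K n : Type*} [CommRing K] [Fintype n] [DecidableEq n]
    (A : Matrix n n K) (a c : n → K) :
    (Matrix.of fun k i => A k i - a k * c i).det =
      A.det - ∑ k, a k * (A.updateRow k c).det :=
  alternating_sub_smul (Matrix.detRowAlternating (n := n) (R := K)) A a c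

/-- The product of the factors is absorbed into the columns, which leaves a rank-one perturbation of
the alternant matrix. -/
theorem alt_Gamma_ιMulti (r : ℕ) (J : Fin r → ℕ) :
    (∏ i : Fin r, factor i) * topForm _ r (sigmaSigmaBarEval r
        (exteriorPower.ιMulti ℤ r fun k => b (J k) : ⋀[ℤ]^r M)) =
      HahnSeries.C (alternant r J) - (1 - mapSym r (z r * wInv r)) *
        ∑ k, mapSym r (wInv r) ^ J k *
          Matrix.det ((Matrix.of fun k i : Fin r =>
            (xs i : HahnSeries (ℤ × ℤ) (S r)) ^ J k).updateRow k geom) := by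
  rw [exteriorPower.ιMulti_apply_coe, ringHom_ιMulti _ _ _ fun k => sigmaSigmaBarEval_b r (J k),
    topForm_ιMulti, ← Matrix.det_mul_row, C_alternant, Finset.mul_sum]
  simp_rw [Matrix.of_apply, factor_mul, ← mul_assoc]
  exact det_sub_mul_row (Matrix.of fun k i : Fin r => xs i ^ J k)
    (fun k => (1 - mapSym r (z r * wInv r)) * mapSym r (wInv r) ^ J k) geom

/-! ### The generating operator and its comparison with the vertex operator -/

theorem genE_add (r : ℕ) (P Q : B r) : genE r (P + Q) = genE r P + genE r Q := by
  ext q : 2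
  simp only [genE, series, HahnSeries.coeff_add, map_add]
  split_ifs <;> simp

theorem det_updateRow_eq_sum_adjugate {R n : Type*} [CommRing R] [Fintype n] [DecidableEq n]
    (A : Matrix n n R) (k : n) (v : n → R) :
    (A.updateRow k v).det = ∑ i, v i * A.adjugate i k := by
  rw [← Matrix.cramer_transpose_apply, Matrix.cramer_eq_adjugate_mulVec, ← Matrix.adjugate_transpose,
    Matrix.mulVec, dotProduct]
  exact Finset.sum_congr rfl fun i _ => mul_comm _ _

theorem geom_coeff {r : ℕ} (i : Fin r) (q : ℤ × ℤ) :
    (geom i).coeff q = if 0 ≤ q.1 ∧ q.2 = 0 then MvPolynomial.X i ^ q.1.toNat else 0 := by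
  obtain ⟨m, n⟩ := q
  by_cases hq : ∃ l : ℕ, l • ((1 : ℤ), (0 : ℤ)) = (m, n)
  · obtain ⟨l, hl⟩ := hq
    rw [← hl, geom, subst_coeff_nsmul]
    simp
  · rw [geom, subst_coeff_of_ne _ _ _ _ fun l hl => hq ⟨l, hl⟩, if_neg]
    rintro ⟨h1, h2⟩
    exact hq ⟨m.toNat, by simp at h1 h2 ⊢; omega⟩

/-- All rows but the k-th are constant series, so the cofactors along row k are constants and
coefficients can be read off inside that row. -/
theorem det_updateRow_geom (r : ℕ) (J : Fin r → ℕ) (k : Fin r) (q : ℤ × ℤ) :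
    (Matrix.det ((Matrix.of fun k i : Fin r =>
        (xs i : HahnSeries (ℤ × ℤ) (S r)) ^ J k).updateRow k geom)).coeff q =
      if 0 ≤ q.1 ∧ q.2 = 0 then alternant r (Function.update J k q.1.toNat) else 0 := by
  let A : Matrix (Fin r) (Fin r) (S r) := Matrix.of fun k i => MvPolynomial.X i ^ J k
  have h1 : (Matrix.of fun k i : Fin r => (xs i : HahnSeries (ℤ × ℤ) (S r)) ^ J k) =
      (HahnSeries.C (Γ := ℤ × ℤ) (R := S r)).mapMatrix A := by
    ext k i : 2
    simp [A, xs]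
  have h2 : alternant r (Function.update J k q.1.toNat) =
      (A.updateRow k fun i => MvPolynomial.X i ^ q.1.toNat).det := by
    rw [alternant]
    congr 1
    ext l i : 2
    by_cases hl : l = k
    · subst hl; simp
    · simp [hl, A]
  rw [h1, h2, det_updateRow_eq_sum_adjugate, det_updateRow_eq_sum_adjugate, ← RingHom.map_adjugate,
    HahnSeries.coeff_sum]
  simp only [RingHom.mapMatrix_apply, Matrix.map_apply, HahnSeries.C_apply,
    HahnSeries.coeff_mul_single_zero, geom_coeff]
  split_ifs <;> simp

theorem mapSym_wInv_pow (r n : ℕ) :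
    mapSym r (wInv r) ^ n = HahnSeries.single ((0 : ℤ), (n : ℤ)) 1 := by
  rw [wInv, mapSym_single, map_one, HahnSeries.single_pow]
  simp

theorem toSym_symm_phi_mul (r : ℕ) (y : ⋀[ℤ]^r M) :
    toSym r ((phi r).symm y) * (cmat r).det = toSym r (wedgeToB r y) * (cmat r).det := rfl

/-- At z^i w^{-j}, the power w^{-J_k} selects the slots with J_k = j, and the coefficient of 1/(1 -
x z) puts x^i in row k: this is the action of δ(ℰ_{ij}). -/
theorem alt_genE_ιMulti (r : ℕ) (J : Fin r → ℕ) :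
    alt r (genE r ((phi r).symm (exteriorPower.ιMulti ℤ r fun k => b (J k)))) =
      ∑ k, mapSym r (wInv r) ^ J k *
        Matrix.det ((Matrix.of fun k i : Fin r =>
          (xs i : HahnSeries (ℤ × ℤ) (S r)) ^ J k).updateRow k geom) := by
  ext q : 2
  rw [HahnSeries.coeff_sum, alt, HahnSeries.C_apply, HahnSeries.coeff_mul_single_zero, mapSym_coeff]
  simp_rw [mapSym_wInv_pow, HahnSeries.coeff_single_mul, one_mul, det_updateRow_geom]
  simp only [genE, series, LinearEquiv.apply_symm_apply, Prod.fst_sub, Prod.snd_sub, sub_zero]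
  by_cases hq : 0 ≤ q.1 ∧ 0 ≤ q.2
  · rw [if_pos hq, toSym_symm_phi_mul, deltaElem_ιMulti, map_sum, map_sum, Finset.sum_mul]
    refine Finset.sum_congr rfl fun k _ => ?_
    by_cases hk : J k = q.2.toNat
    · rw [if_pos hk, if_pos (by omega), ← alternant_eq]
    · rw [if_neg hk, if_neg (by omega), map_zero, map_zero, zero_mul]
  · rw [if_neg hq, map_zero, zero_mul]
    symm
    refine Finset.sum_eq_zero fun k _ => if_neg ?_
    omega

/-- The main formula with w/(w - z) cleared. Both sides are additive in `P`, so wedges of basis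
vectors suffice. -/
theorem alt_genE (r : ℕ) (P : B r) :
    (1 - mapSym r (z r * wInv r)) * alt r (genE r P) = alt r (HahnSeries.C P) -
      (∏ i : Fin r, factor i) * topForm _ r (sigmaSigmaBarEval r (phi r P : Wedge)) := by
  let genHom : B r →+ Series r := AddMonoidHom.mk' (genE r) (genE_add r)
  let altHom : Series r →+ HahnSeries (ℤ × ℤ) (S r) :=
    (AddMonoidHom.mulRight (HahnSeries.C (cmat r).det)).comp (mapSym r).toAddMonoidHom
  have h1 : ((AddMonoidHom.mulLeft (1 - mapSym r (z r * wInv r))).comp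
        (altHom.comp genHom)).comp (phi r).symm.toAddEquiv.toAddMonoidHom =
      (altHom.comp HahnSeries.C.toAddMonoidHom).comp (phi r).symm.toAddEquiv.toAddMonoidHom -
        (AddMonoidHom.mulLeft (∏ i : Fin r, factor i)).comp
          (((topForm (HahnSeries (ℤ × ℤ) (S r)) r).toAddMonoidHom.comp
            (sigmaSigmaBarEval r).toAddMonoidHom).comp (⋀[ℤ]^r M).subtype.toAddMonoidHom) := by
    apply exteriorPower_addHom_ext
    intro J
    change (1 - mapSym r (z r * wInv r)) * alt r (genE r ((phi r).symm _)) =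
      alt r (HahnSeries.C ((phi r).symm _)) -
        (∏ i : Fin r, factor i) * topForm _ r (sigmaSigmaBarEval r
          (exteriorPower.ιMulti ℤ r fun k => b (J k) : ⋀[ℤ]^r M))
    rw [alt_Gamma_ιMulti, alt_genE_ιMulti, alt, mapSym_C, ← map_mul, toSym_symm_phi_mul,
      ← alternant_eq]
    ring
  have h2 := congrArg (fun f => f (phi r P)) h1
  change (1 - mapSym r (z r * wInv r)) * alt r (genE r ((phi r).symm (phi r P))) =
    alt r (HahnSeries.C ((phi r).symm (phi r P))) - _ at h2
  rw [LinearEquiv.symm_apply_apply] at h2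
  exact h2

theorem alt_sub (r : ℕ) (f g : Series r) : alt r (f - g) = alt r f - alt r g := by
  rw [alt, alt, alt, map_sub, sub_mul]

end FiniteVertex

end

theorem theorem5p6 (r : ℕ) (P : FiniteVertex.B r) :
    FiniteVertex.genE r P =
      FiniteVertex.iwz r *
        (HahnSeries.C P - (FiniteVertex.z r * FiniteVertex.wInv r) ^ r * FiniteVertex.Gamma r P) := by
  -- Multiplying by `iwz`, the inverse of 1 - z/w, recovers the stated form.
  suffices h1 : (1 - FiniteVertex.z r * FiniteVertex.wInv r) * FiniteVertex.genE r P =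
      HahnSeries.C P - (FiniteVertex.z r * FiniteVertex.wInv r) ^ r * FiniteVertex.Gamma r P by
    rw [← h1, ← mul_assoc, FiniteVertex.iwz_mul, one_mul]
  apply FiniteVertex.alt_injective
  rw [FiniteVertex.alt_mul, map_sub, map_one, FiniteVertex.alt_genE, FiniteVertex.alt_sub,
    FiniteVertex.Gamma, ← mul_assoc, FiniteVertex.alt_mul, FiniteVertex.mapSym_prefactor,
    FiniteVertex.alt_sigmaSigmaBar]
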